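/- Conventions. A double category $C$ is a pseudo double category: a category of objects $C_0$ (objects and vertical morphisms), a category $C_1$ (horizontal morphisms and squares, with vertical composition), functors $s,t:C_1\to C_0$, $i:C_0\to C_1$ and $\ast:C_1\times_{C_0}C_1\to C_1$, and globular invertible natural unitors and associator for $\ast$ satisfying the triangle and pentagon axioms. A square is globular if its two vertical sides are identities. $C$ is globularly generated if every square of $C$ is obtained from globular squares and horizontal identity squares $i_f$ ($f$ a vertical morphism) by finitely many vertical and horizontal compositions. A decorated bicategory $\mathcal B$ is a bicategory together with a category $\mathcal B^*$ (its decoration) having the same collection of objects; a decorated pseudofunctor is a pseudofunctor together with a functor of decorations agreeing with it on objects. The decorated horizontalization $H^*C$ is the pair formed by $C_0$ and the horizontal bicategory $HC$ of objects, horizontal morphisms and globular squares of $C$; a strict double functor $F$ (one preserving all the structure on the nose) induces a decorated pseudofunctor $H^*F$. The free globularly generated double category $Q_{\mathcal B}$ has $\mathcal B^*$ as category of objects and the 1-cells of $\mathcal B$ as horizontal morphisms; its squares are the formal vertical and horizontal composites of 2-cells of $\mathcal B$ (as globular squares) and formal squares $i_f$, for $f$ a morphism of $\mathcal B^*$, modulo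 the smallest congruence which makes vertical composition associative and unital, imposes the interchange law, identifies formal vertical and horizontal composites and identities of 2-cells with those of $\mathcal B$ and formal vertical composites and identities of the squares $i_f$ with $i_{gf}$ and $i_{\mathrm{id}}$, the formal identity square of an identity 1-cell being $i_{\mathrm{id}}$, and makes the unitors and associators of $\mathcal B$ natural with respect to all squares. Let $j_{\mathcal B}:\mathcal B\to H^*Q_{\mathcal B}$ be the canonical decorated pseudofunctor which is the identity on 0-cells, 1-cells and vertical morphisms and sends each 2-cell to its class. Theorem. Let $\mathcal B$ be a decorated bicategory and let $C$ be a globularly generated double category with $H^*C=\mathcal B$. Then there is a unique strict double functor $\pi^C:Q_{\mathcal B}\to C$ such that $$H^*\pi^C\restriction_{\mathcal B}=\mathrm{id}_{\mathcal B},\qquad\text{i.e. } H^*\pi^C\circ j_{\mathcal B}=\mathrm{id}_{\mathcal B},$$ and this $\pi^C$ is surjective on squares. -/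

import Mathlib

open CategoryTheory Bicategory

set_option linter.checkUnivs false

universe u x v w u' x' v' w'

/-- A (pseudo) double category: strict in the vertical direction, weak in the horizontal
direction. `Obj` with `vert` is the category of objects `C₀` (vertical morphisms); the category
`C₁` has the horizontal morphisms `HHom` as objects and the squares `Sq` as morphisms, with
identities `vid` and (vertical) composition `vcomp`. The maps `left`, `right` are the source and
target functors `s, t : C₁ ⥤ C₀`, the pair `hid`, `hidSq` is the horizontal identity functor
`i : C₀ ⥤ C₁`, and the pair `hcomp`, `hcompSq` is the horizontal composition functor
`C₁ ×_{C₀} C₁ ⥤ C₁`. All compositions are written in diagrammatic order. -/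
structure DoubleCategory where
  Obj : Type u
  [vert : Category.{x} Obj]
  HHom : Obj → Obj → Type v
  /-- `Sq h k` is the type of squares with top `h` and bottom `k`. -/
  Sq : ∀ {a b c d : Obj}, HHom a b → HHom c d → Type w
  -- the category of squares
  vid : ∀ {a b : Obj} (h : HHom a b), Sq h h
  vcomp : ∀ {a b c d e f : Obj} {h : HHom a b} {k : HHom c d} {l : HHom e f},
    Sq h k → Sq k l → Sq h l
  vid_vcomp : ∀ {a b c d : Obj} {h : HHom a b} {k : HHom c d} (σ : Sq h k),
    vcomp (vid h) σ = σ
  vcomp_vid : ∀ {a b c d : Obj} {h : HHom a b} {k : HHom c d} (σ : Sq h k),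
    vcomp σ (vid k) = σ
  vcomp_assoc : ∀ {a b c d e f p q : Obj} {h : HHom a b} {k : HHom c d} {l : HHom e f}
    {m : HHom p q} (σ : Sq h k) (τ : Sq k l) (υ : Sq l m),
    vcomp (vcomp σ τ) υ = vcomp σ (vcomp τ υ)
  -- the source and target functors
  left : ∀ {a b c d : Obj} {h : HHom a b} {k : HHom c d}, Sq h k → (a ⟶ c)
  right : ∀ {a b c d : Obj} {h : HHom a b} {k : HHom c d}, Sq h k → (b ⟶ d)
  left_vid : ∀ {a b : Obj} (h : HHom a b), left (vid h) = 𝟙 a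
  right_vid : ∀ {a b : Obj} (h : HHom a b), right (vid h) = 𝟙 b
  left_vcomp : ∀ {a b c d e f : Obj} {h : HHom a b} {k : HHom c d} {l : HHom e f}
    (σ : Sq h k) (τ : Sq k l), left (vcomp σ τ) = left σ ≫ left τ
  right_vcomp : ∀ {a b c d e f : Obj} {h : HHom a b} {k : HHom c d} {l : HHom e f}
    (σ : Sq h k) (τ : Sq k l), right (vcomp σ τ) = right σ ≫ right τ
  -- the horizontal identity functor
  hid : ∀ a : Obj, HHom a a
  hidSq : ∀ {a b : Obj} (_ : a ⟶ b), Sq (hid a) (hid b)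
  left_hidSq : ∀ {a b : Obj} (f : a ⟶ b), left (hidSq f) = f
  right_hidSq : ∀ {a b : Obj} (f : a ⟶ b), right (hidSq f) = f
  hidSq_id : ∀ a : Obj, hidSq (𝟙 a) = vid (hid a)
  hidSq_comp : ∀ {a b c : Obj} (f : a ⟶ b) (g : b ⟶ c),
    hidSq (f ≫ g) = vcomp (hidSq f) (hidSq g)
  -- the horizontal composition functor
  hcomp : ∀ {a b c : Obj}, HHom a b → HHom b c → HHom a c
  hcompSq : ∀ {a b c a' b' c' : Obj} {h : HHom a b} {k : HHom b c} {h' : HHom a' b'}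
    {k' : HHom b' c'} (σ : Sq h h') (τ : Sq k k'), right σ = left τ →
    Sq (hcomp h k) (hcomp h' k')
  left_hcompSq : ∀ {a b c a' b' c' : Obj} {h : HHom a b} {k : HHom b c} {h' : HHom a' b'}
    {k' : HHom b' c'} (σ : Sq h h') (τ : Sq k k') (e : right σ = left τ),
    left (hcompSq σ τ e) = left σ
  right_hcompSq : ∀ {a b c a' b' c' : Obj} {h : HHom a b} {k : HHom b c} {h' : HHom a' b'}
    {k' : HHom b' c'} (σ : Sq h h') (τ : Sq k k') (e : right σ = left τ),
    right (hcompSq σ τ e) = right τ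
  hcompSq_vid : ∀ {a b c : Obj} (h : HHom a b) (k : HHom b c),
    hcompSq (vid h) (vid k) ((right_vid h).trans (left_vid k).symm) = vid (hcomp h k)
  interchange : ∀ {a b c a' b' c' a'' b'' c'' : Obj} {h : HHom a b} {k : HHom b c}
    {h' : HHom a' b'} {k' : HHom b' c'} {h'' : HHom a'' b''} {k'' : HHom b'' c''}
    (σ : Sq h h') (τ : Sq k k') (σ' : Sq h' h'') (τ' : Sq k' k'')
    (e : right σ = left τ) (e' : right σ' = left τ'),
    hcompSq (vcomp σ σ') (vcomp τ τ')
        ((right_vcomp σ σ').trans ((congrArg₂ (· ≫ ·) e e').trans (left_vcomp τ τ').symm)) =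
      vcomp (hcompSq σ τ e) (hcompSq σ' τ' e')
  -- the associator: a globular invertible natural transformation
  assoc : ∀ {a b c d : Obj} (h : HHom a b) (k : HHom b c) (l : HHom c d),
    Sq (hcomp (hcomp h k) l) (hcomp h (hcomp k l))
  assocInv : ∀ {a b c d : Obj} (h : HHom a b) (k : HHom b c) (l : HHom c d),
    Sq (hcomp h (hcomp k l)) (hcomp (hcomp h k) l)
  left_assoc : ∀ {a b c d : Obj} (h : HHom a b) (k : HHom b c) (l : HHom c d),
    left (assoc h k l) = 𝟙 a
  right_assoc : ∀ {a b c d : Obj} (h : HHom a b) (k : HHom b c) (l : HHom c d),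
    right (assoc h k l) = 𝟙 d
  left_assocInv : ∀ {a b c d : Obj} (h : HHom a b) (k : HHom b c) (l : HHom c d),
    left (assocInv h k l) = 𝟙 a
  right_assocInv : ∀ {a b c d : Obj} (h : HHom a b) (k : HHom b c) (l : HHom c d),
    right (assocInv h k l) = 𝟙 d
  assoc_assocInv : ∀ {a b c d : Obj} (h : HHom a b) (k : HHom b c) (l : HHom c d),
    vcomp (assoc h k l) (assocInv h k l) = vid _
  assocInv_assoc : ∀ {a b c d : Obj} (h : HHom a b) (k : HHom b c) (l : HHom c d),
    vcomp (assocInv h k l) (assoc h k l) = vid _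
  assoc_natural : ∀ {a b c d a' b' c' d' : Obj} {h : HHom a b} {k : HHom b c} {l : HHom c d}
    {h' : HHom a' b'} {k' : HHom b' c'} {l' : HHom c' d'}
    (σ : Sq h h') (τ : Sq k k') (υ : Sq l l') (e : right σ = left τ) (e' : right τ = left υ),
    vcomp (hcompSq (hcompSq σ τ e) υ ((right_hcompSq σ τ e).trans e')) (assoc h' k' l') =
      vcomp (assoc h k l) (hcompSq σ (hcompSq τ υ e') (e.trans (left_hcompSq τ υ e').symm))
  -- the left unitor
  lunit : ∀ {a b : Obj} (h : HHom a b), Sq (hcomp (hid a) h) h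
  lunitInv : ∀ {a b : Obj} (h : HHom a b), Sq h (hcomp (hid a) h)
  left_lunit : ∀ {a b : Obj} (h : HHom a b), left (lunit h) = 𝟙 a
  right_lunit : ∀ {a b : Obj} (h : HHom a b), right (lunit h) = 𝟙 b
  left_lunitInv : ∀ {a b : Obj} (h : HHom a b), left (lunitInv h) = 𝟙 a
  right_lunitInv : ∀ {a b : Obj} (h : HHom a b), right (lunitInv h) = 𝟙 b
  lunit_lunitInv : ∀ {a b : Obj} (h : HHom a b), vcomp (lunit h) (lunitInv h) = vid _
  lunitInv_lunit : ∀ {a b : Obj} (h : HHom a b), vcomp (lunitInv h) (lunit h) = vid _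
  lunit_natural : ∀ {a b c d : Obj} {h : HHom a b} {k : HHom c d} (σ : Sq h k),
    vcomp (hcompSq (hidSq (left σ)) σ (right_hidSq (left σ))) (lunit k) = vcomp (lunit h) σ
  -- the right unitor
  runit : ∀ {a b : Obj} (h : HHom a b), Sq (hcomp h (hid b)) h
  runitInv : ∀ {a b : Obj} (h : HHom a b), Sq h (hcomp h (hid b))
  left_runit : ∀ {a b : Obj} (h : HHom a b), left (runit h) = 𝟙 a
  right_runit : ∀ {a b : Obj} (h : HHom a b), right (runit h) = 𝟙 b
  left_runitInv : ∀ {a b : Obj} (h : HHom a b), left (runitInv h) = 𝟙 a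
  right_runitInv : ∀ {a b : Obj} (h : HHom a b), right (runitInv h) = 𝟙 b
  runit_runitInv : ∀ {a b : Obj} (h : HHom a b), vcomp (runit h) (runitInv h) = vid _
  runitInv_runit : ∀ {a b : Obj} (h : HHom a b), vcomp (runitInv h) (runit h) = vid _
  runit_natural : ∀ {a b c d : Obj} {h : HHom a b} {k : HHom c d} (σ : Sq h k),
    vcomp (hcompSq σ (hidSq (right σ)) (left_hidSq (right σ)).symm) (runit k) =
      vcomp (runit h) σ
  -- coherence
  pentagon : ∀ {a b c d p : Obj} (f : HHom a b) (g : HHom b c) (h : HHom c d) (i : HHom d p),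
    vcomp (hcompSq (assoc f g h) (vid i) ((right_assoc f g h).trans (left_vid i).symm))
        (vcomp (assoc f (hcomp g h) i)
          (hcompSq (vid f) (assoc g h i) ((right_vid f).trans (left_assoc g h i).symm))) =
      vcomp (assoc (hcomp f g) h i) (assoc f g (hcomp h i))
  triangle : ∀ {a b c : Obj} (f : HHom a b) (g : HHom b c),
    vcomp (assoc f (hid b) g)
        (hcompSq (vid f) (lunit g) ((right_vid f).trans (left_lunit g).symm)) =
      hcompSq (runit f) (vid g) ((right_runit f).trans (left_vid g).symm)

attribute [instance] DoubleCategory.vert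

/-- A decorated bicategory: a bicategory together with a category (the decoration) having the
same collection of objects. -/
structure DecoratedBicategory where
  Obj : Type u
  bicat : Bicategory.{w, v} Obj
  dec : Category.{x} Obj

namespace DecoratedBicategory

instance (B : DecoratedBicategory.{u, x, v, w}) : Bicategory.{w, v} B.Obj := B.bicat

/-- The 0-cells, regarded as the objects of the decoration. -/
def Vert (B : DecoratedBicategory.{u, x, v, w}) : Type u := B.Obj

instance (B : DecoratedBicategory.{u, x, v, w}) : Category.{x} B.Vert := B.dec

/-- Vertical morphisms: the morphisms of the decoration. -/
abbrev VHom (B : DecoratedBicategory.{u, x, v, w}) (a b : B.Obj) : Type x :=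
  @Quiver.Hom B.Vert _ a b

abbrev vId (B : DecoratedBicategory.{u, x, v, w}) (a : B.Obj) : B.VHom a a :=
  @CategoryStruct.id B.Vert _ a

abbrev vComp (B : DecoratedBicategory.{u, x, v, w}) {a b c : B.Obj} (f : B.VHom a b)
    (g : B.VHom b c) : B.VHom a c :=
  @CategoryStruct.comp B.Vert _ a b c f g

end DecoratedBicategory

/-- A decorated pseudofunctor: a pseudofunctor and a functor between decorations which agree on
objects. -/
@[ext]
structure DecoratedPseudofunctor (B : DecoratedBicategory.{u, x, v, w})
    (B' : DecoratedBicategory.{u', x', v', w'}) where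
  hor : Pseudofunctor B.Obj B'.Obj
  vert : B.Vert ⥤ B'.Vert
  obj_eq : ∀ a : B.Obj, hor.obj a = vert.obj a

namespace DecoratedPseudofunctor

/-- The identity decorated pseudofunctor. -/
def id (B : DecoratedBicategory.{u, x, v, w}) : DecoratedPseudofunctor B B where
  hor := Pseudofunctor.id B.Obj
  vert := 𝟭 B.Vert
  obj_eq _ := rfl

/-- Composition of decorated pseudofunctors, in diagrammatic order. -/
def comp {B : DecoratedBicategory.{u, x, v, w}} {B' : DecoratedBicategory.{u', x', v', w'}}
    {B'' : DecoratedBicategory} (F : DecoratedPseudofunctor B B')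
    (G : DecoratedPseudofunctor B' B'') : DecoratedPseudofunctor B B'' where
  hor := F.hor.comp G.hor
  vert := F.vert ⋙ G.vert
  obj_eq a := (congrArg G.hor.obj (F.obj_eq a)).trans (G.obj_eq _)

/-- For equal decorated bicategories `B = B'`, the identity seen as a decorated pseudofunctor from
`B` to `B'`. -/
def ofEq {B B' : DecoratedBicategory.{u, x, v, w}} (h : B = B') : DecoratedPseudofunctor B B' :=
  h ▸ id B

end DecoratedPseudofunctor

namespace DoubleCategory

section Horizontalization

variable (C : DoubleCategory.{u, x, v, w})

/-- A square is globular if its left and right vertical sides are identities. -/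
def IsGlobular {C : DoubleCategory.{u, x, v, w}} {a b : C.Obj} {h k : C.HHom a b}
    (σ : C.Sq h k) : Prop :=
  C.left σ = 𝟙 a ∧ C.right σ = 𝟙 b

/-- The objects of `C`, regarded as the 0-cells of the horizontal bicategory. -/
def Hor : Type u := C.Obj

/-- The globular squares with given top and bottom. -/
@[ext]
structure Glob {a b : C.Obj} (h k : C.HHom a b) where
  sq : C.Sq h k
  glob : IsGlobular sq

variable {C}

theorem hcompSq_congr {a b c a' b' c' : C.Obj} {h : C.HHom a b} {k : C.HHom b c}
    {h' : C.HHom a' b'} {k' : C.HHom b' c'} {σ σ' : C.Sq h h'} {τ τ' : C.Sq k k'}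
    (hσ : σ = σ') (hτ : τ = τ') (e : C.right σ = C.left τ) (e' : C.right σ' = C.left τ') :
    C.hcompSq σ τ e = C.hcompSq σ' τ' e' := by
  subst hσ hτ; rfl

theorem IsGlobular.compat {a b c : C.Obj} {h h' : C.HHom a b} {k k' : C.HHom b c}
    {σ : C.Sq h h'} {τ : C.Sq k k'} (hσ : IsGlobular σ) (hτ : IsGlobular τ) :
    C.right σ = C.left τ := hσ.2.trans hτ.1.symm

theorem IsGlobular.vid {a b : C.Obj} (h : C.HHom a b) : IsGlobular (C.vid h) :=
  ⟨C.left_vid h, C.right_vid h⟩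

theorem IsGlobular.vcomp {a b : C.Obj} {h k l : C.HHom a b} {σ : C.Sq h k} {τ : C.Sq k l}
    (hσ : IsGlobular σ) (hτ : IsGlobular τ) : IsGlobular (C.vcomp σ τ) :=
  ⟨by rw [C.left_vcomp, hσ.1, hτ.1, Category.id_comp],
    by rw [C.right_vcomp, hσ.2, hτ.2, Category.id_comp]⟩

theorem IsGlobular.hcompSq {a b c : C.Obj} {h h' : C.HHom a b} {k k' : C.HHom b c}
    {σ : C.Sq h h'} {τ : C.Sq k k'} (hσ : IsGlobular σ) (hτ : IsGlobular τ) :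
    IsGlobular (C.hcompSq σ τ (hσ.compat hτ)) :=
  ⟨by rw [C.left_hcompSq, hσ.1], by rw [C.right_hcompSq, hτ.2]⟩

/-- Horizontal composition of globular squares. -/
def Glob.hcomp {a b c : C.Obj} {h h' : C.HHom a b} {k k' : C.HHom b c} (σ : C.Glob h h')
    (τ : C.Glob k k') : C.Glob (C.hcomp h k) (C.hcomp h' k') :=
  ⟨C.hcompSq σ.sq τ.sq (σ.glob.compat τ.glob), σ.glob.hcompSq τ.glob⟩

theorem lunit_natural_glob {a b : C.Obj} {h k : C.HHom a b} {σ : C.Sq h k} (hσ : IsGlobular σ) :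
    C.vcomp (C.hcompSq (C.vid (C.hid a)) σ ((IsGlobular.vid _).compat hσ)) (C.lunit k) =
      C.vcomp (C.lunit h) σ := by
  rw [← C.lunit_natural σ]
  congr 1
  exact hcompSq_congr (by rw [hσ.1, C.hidSq_id]) rfl _ _

theorem runit_natural_glob {a b : C.Obj} {h k : C.HHom a b} {σ : C.Sq h k} (hσ : IsGlobular σ) :
    C.vcomp (C.hcompSq σ (C.vid (C.hid b)) (hσ.compat (IsGlobular.vid _))) (C.runit k) =
      C.vcomp (C.runit h) σ := by
  rw [← C.runit_natural σ]
  congr 1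
  exact hcompSq_congr rfl (by rw [hσ.2, C.hidSq_id]) _ _

theorem eq_vcomp_of_vcomp_eq {a b : C.Obj} {h h' k k' : C.HHom a b} {σ : C.Sq h k}
    {i : C.Sq k k'} {j : C.Sq k' k} {p : C.Sq h h'} {τ : C.Sq h' k'} (hij : C.vcomp i j = C.vid _)
    (H : C.vcomp σ i = C.vcomp p τ) : σ = C.vcomp p (C.vcomp τ j) := by
  rw [← C.vcomp_assoc, ← H, C.vcomp_assoc, hij, C.vcomp_vid]

theorem eq_vcomp_of_vcomp_eq' {a b : C.Obj} {h h' k k' : C.HHom a b} {σ : C.Sq h k}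
    {i : C.Sq k k'} {p : C.Sq h h'} {q : C.Sq h' h} {τ : C.Sq h' k'} (hqp : C.vcomp q p = C.vid _)
    (H : C.vcomp σ i = C.vcomp p τ) : τ = C.vcomp q (C.vcomp σ i) := by
  rw [H, ← C.vcomp_assoc, hqp, C.vid_vcomp]

theorem hcomp_exchange {a b c : C.Obj} {h h' h'' : C.HHom a b} {k k' k'' : C.HHom b c}
    (σ : C.Glob h h') (σ' : C.Glob h' h'') (τ : C.Glob k k') (τ' : C.Glob k' k'') :
    C.vcomp (σ.hcomp τ).sq (σ'.hcomp τ').sq =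
      C.hcompSq (C.vcomp σ.sq σ'.sq) (C.vcomp τ.sq τ'.sq)
        ((σ.glob.vcomp σ'.glob).compat (τ.glob.vcomp τ'.glob)) :=
  (C.interchange _ _ _ _ _ _).symm

end Horizontalization

section HorBicategory

variable (C : DoubleCategory.{u, x, v, w})

instance : CategoryStruct.{v} C.Hor where
  Hom a b := C.HHom a b
  id a := C.hid a
  comp h k := C.hcomp h k

instance horHomCategory (a b : C.Hor) : Category.{w} (a ⟶ b) where
  Hom h k := C.Glob h k
  id h := ⟨C.vid h, IsGlobular.vid h⟩
  comp σ τ := ⟨C.vcomp σ.sq τ.sq, σ.glob.vcomp τ.glob⟩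
  id_comp σ := Glob.ext (C.vid_vcomp σ.sq)
  comp_id σ := Glob.ext (C.vcomp_vid σ.sq)
  assoc σ τ υ := Glob.ext (C.vcomp_assoc σ.sq τ.sq υ.sq)

/-- The horizontal bicategory `HC`: 0-cells are the objects, 1-cells the horizontal morphisms and
2-cells the globular squares of `C`. -/
instance horBicategory : Bicategory.{w, v} C.Hor where
  whiskerLeft h _ _ τ := Glob.hcomp ⟨C.vid h, IsGlobular.vid h⟩ τ
  whiskerRight σ k := Glob.hcomp σ ⟨C.vid k, IsGlobular.vid k⟩
  associator h k l :=
    { hom := (⟨C.assoc h k l, C.left_assoc h k l, C.right_assoc h k l⟩ : C.Glob _ _)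
      inv := (⟨C.assocInv h k l, C.left_assocInv h k l, C.right_assocInv h k l⟩ : C.Glob _ _)
      hom_inv_id := Glob.ext (C.assoc_assocInv h k l)
      inv_hom_id := Glob.ext (C.assocInv_assoc h k l) }
  leftUnitor h :=
    { hom := (⟨C.lunit h, C.left_lunit h, C.right_lunit h⟩ : C.Glob _ _)
      inv := (⟨C.lunitInv h, C.left_lunitInv h, C.right_lunitInv h⟩ : C.Glob _ _)
      hom_inv_id := Glob.ext (C.lunit_lunitInv h)
      inv_hom_id := Glob.ext (C.lunitInv_lunit h) }
  rightUnitor h :=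
    { hom := (⟨C.runit h, C.left_runit h, C.right_runit h⟩ : C.Glob _ _)
      inv := (⟨C.runitInv h, C.left_runitInv h, C.right_runitInv h⟩ : C.Glob _ _)
      hom_inv_id := Glob.ext (C.runit_runitInv h)
      inv_hom_id := Glob.ext (C.runitInv_runit h) }
  whiskerLeft_id h k := Glob.ext (C.hcompSq_vid h k)
  whiskerLeft_comp h _ _ _ η θ := Glob.ext
    ((hcompSq_congr (C.vid_vcomp (C.vid h)).symm rfl _ _).trans
      (hcomp_exchange (C := C) ⟨C.vid h, _⟩ ⟨C.vid h, _⟩ η θ).symm)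
  id_whiskerLeft {a b f g} η :=
    Glob.ext (eq_vcomp_of_vcomp_eq (C.lunit_lunitInv g) (lunit_natural_glob (Glob.glob η)))
  comp_whiskerLeft {a b c d} f g h h' η :=
    Glob.ext (eq_vcomp_of_vcomp_eq (C.assoc_assocInv f g h')
      ((congrArg (fun s => C.vcomp s _) (hcompSq_congr (C.hcompSq_vid f g).symm rfl _ _)).trans
        (C.assoc_natural (C.vid f) (C.vid g) (Glob.sq η)
          ((IsGlobular.vid f).compat (IsGlobular.vid g))
          ((IsGlobular.vid g).compat (Glob.glob η)))))
  id_whiskerRight h k := Glob.ext (C.hcompSq_vid h k)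
  comp_whiskerRight η θ i := Glob.ext
    ((hcompSq_congr rfl (C.vid_vcomp (C.vid i)).symm _ _).trans
      (hcomp_exchange (C := C) η θ ⟨C.vid i, _⟩ ⟨C.vid i, _⟩).symm)
  whiskerRight_id {a b f g} η :=
    Glob.ext (eq_vcomp_of_vcomp_eq (C.runit_runitInv g) (runit_natural_glob (Glob.glob η)))
  whiskerRight_comp {a b c d} f f' η g h :=
    Glob.ext (eq_vcomp_of_vcomp_eq' (C.assocInv_assoc f g h)
      ((C.assoc_natural (Glob.sq η) (C.vid g) (C.vid h)
        ((Glob.glob η).compat (IsGlobular.vid g))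
        ((IsGlobular.vid g).compat (IsGlobular.vid h))).trans
          (congrArg (fun s => C.vcomp _ s) (hcompSq_congr rfl (C.hcompSq_vid g h) _ _))))
  whisker_assoc {a b c d} f g g' η h :=
    Glob.ext (eq_vcomp_of_vcomp_eq (C.assoc_assocInv f g' h)
      (C.assoc_natural (C.vid f) (Glob.sq η) (C.vid h)
        ((IsGlobular.vid f).compat (Glob.glob η)) ((Glob.glob η).compat (IsGlobular.vid h))))
  whisker_exchange {a b c f g h i} η θ := Glob.ext
    ((hcomp_exchange (C := C) ⟨C.vid f, IsGlobular.vid _⟩ η θ ⟨C.vid i, IsGlobular.vid _⟩).trans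
      ((hcompSq_congr ((C.vid_vcomp (Glob.sq η)).trans (C.vcomp_vid (Glob.sq η)).symm)
        ((C.vcomp_vid (Glob.sq θ)).trans (C.vid_vcomp (Glob.sq θ)).symm) _ _).trans
      (hcomp_exchange (C := C) η ⟨C.vid g, IsGlobular.vid _⟩
        ⟨C.vid h, IsGlobular.vid _⟩ θ).symm))
  pentagon f g h i := Glob.ext (C.pentagon f g h i)
  triangle f g := Glob.ext (C.triangle f g)

/-- The decorated horizontalization `H^* C = (C₀, HC)`. -/
def decHor : DecoratedBicategory.{u, x, v, w} where
  Obj := C.Obj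
  bicat := horBicategory C
  dec := C.vert

/-- The squares obtained from globular squares and horizontal identity squares by finitely many
vertical and horizontal compositions. -/
inductive GlobularlyGeneratedSq : ∀ {a b c d : C.Obj} {h : C.HHom a b} {k : C.HHom c d},
    C.Sq h k → Prop
  | glob {a b : C.Obj} {h k : C.HHom a b} (σ : C.Sq h k) (hσ : IsGlobular σ) :
      GlobularlyGeneratedSq σ
  | hidSq {a b : C.Obj} (f : a ⟶ b) : GlobularlyGeneratedSq (C.hidSq f)
  | vcomp {a b c d e f : C.Obj} {h : C.HHom a b} {k : C.HHom c d} {l : C.HHom e f}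
      (σ : C.Sq h k) (τ : C.Sq k l) :
      GlobularlyGeneratedSq σ → GlobularlyGeneratedSq τ → GlobularlyGeneratedSq (C.vcomp σ τ)
  | hcompSq {a b c a' b' c' : C.Obj} {h : C.HHom a b} {k : C.HHom b c} {h' : C.HHom a' b'}
      {k' : C.HHom b' c'} (σ : C.Sq h h') (τ : C.Sq k k') (e : C.right σ = C.left τ) :
      GlobularlyGeneratedSq σ → GlobularlyGeneratedSq τ →
      GlobularlyGeneratedSq (C.hcompSq σ τ e)

/-- A double category is globularly generated if every square is a vertical and horizontal
composition of globular squares and horizontal identity squares. -/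
def IsGlobularlyGenerated : Prop :=
  ∀ {a b c d : C.Obj} {h : C.HHom a b} {k : C.HHom c d} (σ : C.Sq h k),
    C.GlobularlyGeneratedSq σ

/-- The collection of all squares, with arbitrary boundary. -/
structure Square where
  {a b c d : C.Obj}
  top : C.HHom a b
  bot : C.HHom c d
  sq : C.Sq top bot

end HorBicategory

end DoubleCategory

/-- A strict double functor: all the structure, including horizontal identities, horizontal
composition, associators and unitors, is preserved on the nose. Equalities between squares whose
boundaries are only propositionally equal are stated as heterogeneous equalities. -/
@[ext]
structure StrictDoubleFunctor (C : DoubleCategory.{u, x, v, w})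
    (D : DoubleCategory.{u', x', v', w'}) where
  vert : C.Obj ⥤ D.Obj
  mapH : ∀ {a b : C.Obj}, C.HHom a b → D.HHom (vert.obj a) (vert.obj b)
  mapSq : ∀ {a b c d : C.Obj} {h : C.HHom a b} {k : C.HHom c d},
    C.Sq h k → D.Sq (mapH h) (mapH k)
  left_mapSq : ∀ {a b c d : C.Obj} {h : C.HHom a b} {k : C.HHom c d} (σ : C.Sq h k),
    D.left (mapSq σ) = vert.map (C.left σ)
  right_mapSq : ∀ {a b c d : C.Obj} {h : C.HHom a b} {k : C.HHom c d} (σ : C.Sq h k),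
    D.right (mapSq σ) = vert.map (C.right σ)
  map_vid : ∀ {a b : C.Obj} (h : C.HHom a b), mapSq (C.vid h) = D.vid (mapH h)
  map_vcomp : ∀ {a b c d e f : C.Obj} {h : C.HHom a b} {k : C.HHom c d} {l : C.HHom e f}
    (σ : C.Sq h k) (τ : C.Sq k l), mapSq (C.vcomp σ τ) = D.vcomp (mapSq σ) (mapSq τ)
  map_hid : ∀ a : C.Obj, mapH (C.hid a) = D.hid (vert.obj a)
  map_hidSq : ∀ {a b : C.Obj} (f : a ⟶ b), HEq (mapSq (C.hidSq f)) (D.hidSq (vert.map f))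
  map_hcomp : ∀ {a b c : C.Obj} (h : C.HHom a b) (k : C.HHom b c),
    mapH (C.hcomp h k) = D.hcomp (mapH h) (mapH k)
  map_hcompSq : ∀ {a b c a' b' c' : C.Obj} {h : C.HHom a b} {k : C.HHom b c}
    {h' : C.HHom a' b'} {k' : C.HHom b' c'} (σ : C.Sq h h') (τ : C.Sq k k')
    (e : C.right σ = C.left τ),
    HEq (mapSq (C.hcompSq σ τ e)) (D.hcompSq (mapSq σ) (mapSq τ)
      ((right_mapSq σ).trans ((congrArg vert.map e).trans (left_mapSq τ).symm)))
  map_assoc : ∀ {a b c d : C.Obj} (h : C.HHom a b) (k : C.HHom b c) (l : C.HHom c d),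
    HEq (mapSq (C.assoc h k l)) (D.assoc (mapH h) (mapH k) (mapH l))
  map_lunit : ∀ {a b : C.Obj} (h : C.HHom a b), HEq (mapSq (C.lunit h)) (D.lunit (mapH h))
  map_runit : ∀ {a b : C.Obj} (h : C.HHom a b), HEq (mapSq (C.runit h)) (D.runit (mapH h))

namespace StrictDoubleFunctor

open DoubleCategory

section

variable {C : DoubleCategory.{u, x, v, w}} {D : DoubleCategory.{u', x', v', w'}}
  (F : StrictDoubleFunctor C D)

/-- The action of a strict double functor on the collection of all squares. -/
def mapSquare (s : C.Square) : D.Square := ⟨F.mapH s.top, F.mapH s.bot, F.mapSq s.sq⟩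

/-- Surjectivity on squares. -/
def SurjectiveOnSquares : Prop := Function.Surjective F.mapSquare

/-- The action of a strict double functor on globular squares. -/
def mapGlob {a b : C.Obj} {h k : C.HHom a b} (σ : C.Glob h k) : D.Glob (F.mapH h) (F.mapH k) :=
  ⟨F.mapSq σ.sq, by rw [F.left_mapSq, σ.glob.1, F.vert.map_id],
    by rw [F.right_mapSq, σ.glob.2, F.vert.map_id]⟩

theorem eq_of_heq_sq {a b : D.Hor} {h h' k k' : a ⟶ b} (eh : h = h') (ek : k = k')
    (σ : h ⟶ k) (τ : h' ⟶ k') (H : HEq (Glob.sq σ) (Glob.sq τ)) :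
    σ = eqToHom eh ≫ τ ≫ eqToHom ek.symm := by
  subst eh ek
  simpa using Glob.ext (eq_of_heq H)

theorem eq_of_heq_sq_left {a b : D.Hor} {h h' k : a ⟶ b} (eh : h = h')
    (σ : h ⟶ k) (τ : h' ⟶ k) (H : HEq (Glob.sq σ) (Glob.sq τ)) :
    σ = eqToHom eh ≫ τ := by
  subst eh
  simpa using Glob.ext (eq_of_heq H)

/-- The strict pseudofunctor between horizontal bicategories induced by a strict double
functor. -/
def horStrict : StrictPseudofunctor C.Hor D.Hor :=
  StrictPseudofunctor.mk'
    { obj := F.vert.obj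
      map := fun h => F.mapH h
      map₂ := fun σ => F.mapGlob σ
      map₂_id := fun h => Glob.ext (F.map_vid h)
      map₂_comp := fun σ τ => Glob.ext (F.map_vcomp (Glob.sq σ) (Glob.sq τ))
      map_id := fun a => F.map_hid a
      map_comp := fun h k => F.map_hcomp h k
      map₂_whisker_left := fun h k k' η => by
        refine eq_of_heq_sq (F.map_hcomp h k) (F.map_hcomp h k') _ _
          ((F.map_hcompSq (C.vid h) (Glob.sq η) _).trans (heq_of_eq ?_))
        exact hcompSq_congr (F.map_vid h) rfl _ _
      map₂_whisker_right := fun {a b c h h'} η k => by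
        refine eq_of_heq_sq (F.map_hcomp h k) (F.map_hcomp h' k) _ _
          ((F.map_hcompSq (Glob.sq η) (C.vid k) _).trans (heq_of_eq ?_))
        exact hcompSq_congr rfl (F.map_vid k) _ _
      map₂_left_unitor := fun {a b} h =>
        eq_of_heq_sq_left (D := D) ((F.map_hcomp (C.hid a) h).trans
          (congrArg (fun t => D.hcomp t (F.mapH h)) (F.map_hid a))) _ _ (F.map_lunit h)
      map₂_right_unitor := fun {a b} h =>
        eq_of_heq_sq_left (D := D) ((F.map_hcomp h (C.hid b)).trans
          (congrArg (fun t => D.hcomp (F.mapH h) t) (F.map_hid b))) _ _ (F.map_runit h)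
      map₂_associator := fun {a b c d} h k l =>
        eq_of_heq_sq (D := D)
          ((F.map_hcomp (C.hcomp h k) l).trans
            (congrArg (fun t => D.hcomp t (F.mapH l)) (F.map_hcomp h k)))
          ((F.map_hcomp h (C.hcomp k l)).trans
            (congrArg (fun t => D.hcomp (F.mapH h) t) (F.map_hcomp k l)))
          _ _ (F.map_assoc h k l) }

/-- The decorated horizontalization `H^* F` of a strict double functor `F`. -/
def decHor : DecoratedPseudofunctor C.decHor D.decHor where
  hor := F.horStrict.toPseudofunctor
  vert := F.vert
  obj_eq _ := rfl

end

end StrictDoubleFunctor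

namespace DecoratedBicategory

variable (B : DecoratedBicategory.{u, x, v, w})

/-- Formal squares over a decorated bicategory `B`, with top and bottom 1-cells of `B` and left and
right sides in the decoration. The generators are the 2-cells of `B`, seen as squares with
identity vertical sides, and a formal horizontal identity square for each vertical morphism; they
are closed under formal identities, vertical and horizontal composition. -/
inductive FormalSq : ∀ {a b c d : B.Obj}, (a ⟶ b) → (c ⟶ d) → B.VHom a c → B.VHom b d →
    Type (max u x v w)
  | cell {a b : B.Obj} {h k : a ⟶ b} (η : h ⟶ k) : FormalSq h k (B.vId a) (B.vId b)
  | unit {a b : B.Obj} (f : B.VHom a b) : FormalSq (𝟙 a) (𝟙 b) f f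
  | vid {a b : B.Obj} (h : a ⟶ b) : FormalSq h h (B.vId a) (B.vId b)
  | vcomp {a b c d p q : B.Obj} {h : a ⟶ b} {k : c ⟶ d} {l : p ⟶ q} {f : B.VHom a c}
      {g : B.VHom b d} {f' : B.VHom c p} {g' : B.VHom d q} (σ : FormalSq h k f g)
      (τ : FormalSq k l f' g') : FormalSq h l (B.vComp f f') (B.vComp g g')
  | hcomp {a b c a' b' c' : B.Obj} {h : a ⟶ b} {k : b ⟶ c} {h' : a' ⟶ b'} {k' : b' ⟶ c'}
      {f : B.VHom a a'} {g g' : B.VHom b b'} {e : B.VHom c c'} (σ : FormalSq h h' f g)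
      (τ : FormalSq k k' g' e) (hg : g = g') : FormalSq (h ≫ k) (h' ≫ k') f e

/-- The relation on formal squares defining the free globularly generated double category: the
smallest equivalence relation compatible with both compositions, for which vertical composition is
associative and unital, the interchange law holds, vertical and horizontal compositions (and
identities) of 2-cells and vertical compositions (and identities) of horizontal identity squares
are those of `B` and of its decoration, and the unitors and associators of `B` are natural with
respect to all squares. Related squares have equal top and bottom by construction, and equal
vertical sides by `FormalRel.sides`. -/
inductive FormalRel : ∀ {a b c d : B.Obj} {h : a ⟶ b} {k : c ⟶ d} {f f' : B.VHom a c}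
    {g g' : B.VHom b d}, FormalSq B h k f g → FormalSq B h k f' g' → Prop
  | refl {a b c d : B.Obj} {h : a ⟶ b} {k : c ⟶ d} {f : B.VHom a c} {g : B.VHom b d}
      (σ : FormalSq B h k f g) : FormalRel σ σ
  | symm {a b c d : B.Obj} {h : a ⟶ b} {k : c ⟶ d} {f f' : B.VHom a c} {g g' : B.VHom b d}
      {σ : FormalSq B h k f g} {σ' : FormalSq B h k f' g'} : FormalRel σ σ' → FormalRel σ' σ
  | trans {a b c d : B.Obj} {h : a ⟶ b} {k : c ⟶ d} {f f' f'' : B.VHom a c}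
      {g g' g'' : B.VHom b d} {σ : FormalSq B h k f g} {σ' : FormalSq B h k f' g'}
      {σ'' : FormalSq B h k f'' g''} : FormalRel σ σ' → FormalRel σ' σ'' → FormalRel σ σ''
  -- compatibility with the two compositions
  | vcomp_congr {a b c d p q : B.Obj} {h : a ⟶ b} {k : c ⟶ d} {l : p ⟶ q}
      {f₁ f₂ : B.VHom a c} {g₁ g₂ : B.VHom b d} {f₁' f₂' : B.VHom c p} {g₁' g₂' : B.VHom d q}
      {σ₁ : FormalSq B h k f₁ g₁} {σ₂ : FormalSq B h k f₂ g₂}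
      {τ₁ : FormalSq B k l f₁' g₁'} {τ₂ : FormalSq B k l f₂' g₂'} :
      FormalRel σ₁ σ₂ → FormalRel τ₁ τ₂ → FormalRel (σ₁.vcomp τ₁) (σ₂.vcomp τ₂)
  | hcomp_congr {a b c a' b' c' : B.Obj} {h : a ⟶ b} {k : b ⟶ c} {h' : a' ⟶ b'}
      {k' : b' ⟶ c'} {f₁ f₂ : B.VHom a a'} {g₁ g₂ g₁' g₂' : B.VHom b b'}
      {e₁ e₂ : B.VHom c c'} {σ₁ : FormalSq B h h' f₁ g₁} {σ₂ : FormalSq B h h' f₂ g₂}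
      {τ₁ : FormalSq B k k' g₁' e₁} {τ₂ : FormalSq B k k' g₂' e₂} (w₁ : g₁ = g₁')
      (w₂ : g₂ = g₂') :
      FormalRel σ₁ σ₂ → FormalRel τ₁ τ₂ → FormalRel (σ₁.hcomp τ₁ w₁) (σ₂.hcomp τ₂ w₂)
  -- formal squares form a category
  | vid_vcomp {a b c d : B.Obj} {h : a ⟶ b} {k : c ⟶ d} {f : B.VHom a c} {g : B.VHom b d}
      (σ : FormalSq B h k f g) : FormalRel ((FormalSq.vid h).vcomp σ) σ
  | vcomp_vid {a b c d : B.Obj} {h : a ⟶ b} {k : c ⟶ d} {f : B.VHom a c} {g : B.VHom b d}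
      (σ : FormalSq B h k f g) : FormalRel (σ.vcomp (FormalSq.vid k)) σ
  | vcomp_assoc {a b c d p q r s : B.Obj} {h : a ⟶ b} {k : c ⟶ d} {l : p ⟶ q} {m : r ⟶ s}
      {f : B.VHom a c} {g : B.VHom b d} {f' : B.VHom c p} {g' : B.VHom d q} {f'' : B.VHom p r}
      {g'' : B.VHom q s} (σ : FormalSq B h k f g) (τ : FormalSq B k l f' g')
      (υ : FormalSq B l m f'' g'') :
      FormalRel ((σ.vcomp τ).vcomp υ) (σ.vcomp (τ.vcomp υ))
  -- horizontal composition is functorial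
  | interchange {a b c a' b' c' a'' b'' c'' : B.Obj} {h : a ⟶ b} {k : b ⟶ c} {h' : a' ⟶ b'}
      {k' : b' ⟶ c'} {h'' : a'' ⟶ b''} {k'' : b'' ⟶ c''} {f : B.VHom a a'}
      {g₁ g₂ : B.VHom b b'} {e : B.VHom c c'} {f' : B.VHom a' a''} {g₁' g₂' : B.VHom b' b''}
      {e' : B.VHom c' c''} (σ : FormalSq B h h' f g₁) (τ : FormalSq B k k' g₂ e)
      (σ' : FormalSq B h' h'' f' g₁') (τ' : FormalSq B k' k'' g₂' e') (hg : g₁ = g₂)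
      (hg' : g₁' = g₂') :
      FormalRel ((σ.vcomp σ').hcomp (τ.vcomp τ') (congrArg₂ B.vComp hg hg'))
        ((σ.hcomp τ hg).vcomp (σ'.hcomp τ' hg'))
  -- compositions of 2-cells and of horizontal identity squares
  | cell_id {a b : B.Obj} (h : a ⟶ b) : FormalRel (FormalSq.cell (𝟙 h)) (FormalSq.vid h)
  | cell_vcomp {a b : B.Obj} {h k l : a ⟶ b} (η : h ⟶ k) (θ : k ⟶ l) :
      FormalRel ((FormalSq.cell η).vcomp (FormalSq.cell θ)) (FormalSq.cell (η ≫ θ))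
  | unit_id (a : B.Obj) : FormalRel (FormalSq.unit (B.vId a)) (FormalSq.vid (𝟙 a))
  | unit_vcomp {a b c : B.Obj} (f : B.VHom a b) (g : B.VHom b c) :
      FormalRel ((FormalSq.unit f).vcomp (FormalSq.unit g)) (FormalSq.unit (B.vComp f g))
  | cell_hcomp {a b c : B.Obj} {h h' : a ⟶ b} {k k' : b ⟶ c} (η : h ⟶ h') (θ : k ⟶ k') :
      FormalRel ((FormalSq.cell η).hcomp (FormalSq.cell θ) rfl)
        (FormalSq.cell (η ▷ k ≫ h' ◁ θ))
  -- naturality of unitors and associators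
  | lunit_natural {a b c d : B.Obj} {h : a ⟶ b} {k : c ⟶ d} {f : B.VHom a c} {g : B.VHom b d}
      (σ : FormalSq B h k f g) :
      FormalRel (((FormalSq.unit f).hcomp σ rfl).vcomp (FormalSq.cell (λ_ k).hom))
        ((FormalSq.cell (λ_ h).hom).vcomp σ)
  | runit_natural {a b c d : B.Obj} {h : a ⟶ b} {k : c ⟶ d} {f : B.VHom a c} {g : B.VHom b d}
      (σ : FormalSq B h k f g) :
      FormalRel ((σ.hcomp (FormalSq.unit g) rfl).vcomp (FormalSq.cell (ρ_ k).hom))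
        ((FormalSq.cell (ρ_ h).hom).vcomp σ)
  | assoc_natural {a b c d a' b' c' d' : B.Obj} {h : a ⟶ b} {k : b ⟶ c} {l : c ⟶ d}
      {h' : a' ⟶ b'} {k' : b' ⟶ c'} {l' : c' ⟶ d'} {f : B.VHom a a'} {g₁ g₂ : B.VHom b b'}
      {e₁ e₂ : B.VHom c c'} {r : B.VHom d d'} (σ : FormalSq B h h' f g₁)
      (τ : FormalSq B k k' g₂ e₁) (υ : FormalSq B l l' e₂ r) (hg : g₁ = g₂) (he : e₁ = e₂) :
      FormalRel (((σ.hcomp τ hg).hcomp υ he).vcomp (FormalSq.cell (α_ h' k' l').hom))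
        ((FormalSq.cell (α_ h k l).hom).vcomp (σ.hcomp (τ.hcomp υ he) hg))

theorem FormalRel.sides {B : DecoratedBicategory.{u, x, v, w}} {a b c d : B.Obj} {h : a ⟶ b}
    {k : c ⟶ d} {f f' : B.VHom a c} {g g' : B.VHom b d} {σ : FormalSq B h k f g}
    {σ' : FormalSq B h k f' g'} (H : FormalRel B σ σ') : f = f' ∧ g = g' := by
  induction H with
  | refl => exact ⟨rfl, rfl⟩
  | symm _ ih => exact ⟨ih.1.symm, ih.2.symm⟩
  | trans _ _ ih ih' => exact ⟨ih.1.trans ih'.1, ih.2.trans ih'.2⟩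
  | vcomp_congr _ _ ih ih' =>
    exact ⟨congrArg₂ B.vComp ih.1 ih'.1, congrArg₂ B.vComp ih.2 ih'.2⟩
  | hcomp_congr _ _ _ _ ih ih' => exact ⟨ih.1, ih'.2⟩
  | vid_vcomp | cell_vcomp => exact ⟨Category.id_comp _, Category.id_comp _⟩
  | vcomp_vid => exact ⟨Category.comp_id _, Category.comp_id _⟩
  | vcomp_assoc => exact ⟨Category.assoc _ _ _, Category.assoc _ _ _⟩
  | lunit_natural | runit_natural | assoc_natural =>
    exact ⟨(Category.comp_id _).trans (Category.id_comp _).symm,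
      (Category.comp_id _).trans (Category.id_comp _).symm⟩
  | _ => exact ⟨rfl, rfl⟩

/-- Formal squares with given top and bottom and arbitrary vertical sides. -/
structure FormalSquare {a b c d : B.Obj} (h : a ⟶ b) (k : c ⟶ d) where
  left : B.VHom a c
  right : B.VHom b d
  sq : FormalSq B h k left right

instance formalSetoid {a b c d : B.Obj} (h : a ⟶ b) (k : c ⟶ d) :
    Setoid (FormalSquare B h k) where
  r σ τ := FormalRel B σ.sq τ.sq
  iseqv := ⟨fun σ => .refl σ.sq, fun H => .symm H, fun H H' => .trans H H'⟩

/-- The squares of the free globularly generated double category: classes of formal squares. -/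
def FreeSq {a b c d : B.Obj} (h : a ⟶ b) (k : c ⟶ d) : Type (max u x v w) :=
  Quotient (formalSetoid B h k)

namespace FreeSq

variable {B}

/-- The class of a formal square. -/
def mk {a b c d : B.Obj} {h : a ⟶ b} {k : c ⟶ d} {f : B.VHom a c} {g : B.VHom b d}
    (σ : FormalSq B h k f g) : FreeSq B h k :=
  Quotient.mk _ ⟨f, g, σ⟩

theorem sound {a b c d : B.Obj} {h : a ⟶ b} {k : c ⟶ d} {f f' : B.VHom a c}
    {g g' : B.VHom b d} {σ : FormalSq B h k f g} {σ' : FormalSq B h k f' g'}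
    (H : FormalRel B σ σ') : mk σ = mk σ' :=
  Quotient.sound H

def left {a b c d : B.Obj} {h : a ⟶ b} {k : c ⟶ d} (σ : FreeSq B h k) : B.VHom a c :=
  Quotient.lift FormalSquare.left (fun _ _ H => (FormalRel.sides H).1) σ

def right {a b c d : B.Obj} {h : a ⟶ b} {k : c ⟶ d} (σ : FreeSq B h k) : B.VHom b d :=
  Quotient.lift FormalSquare.right (fun _ _ H => (FormalRel.sides H).2) σ

def vcomp {a b c d p q : B.Obj} {h : a ⟶ b} {k : c ⟶ d} {l : p ⟶ q} (σ : FreeSq B h k)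
    (τ : FreeSq B k l) : FreeSq B h l :=
  Quotient.lift₂ (fun s t => mk (s.sq.vcomp t.sq))
    (fun _ _ _ _ H H' => sound (FormalRel.vcomp_congr H H')) σ τ

def hcomp {a b c a' b' c' : B.Obj} {h : a ⟶ b} {k : b ⟶ c} {h' : a' ⟶ b'} {k' : b' ⟶ c'}
    (σ : FreeSq B h h') (τ : FreeSq B k k') (e : σ.right = τ.left) :
    FreeSq B (h ≫ k) (h' ≫ k') :=
  Quotient.hrecOn₂ σ τ (φ := fun σ τ => FreeSq.right σ = FreeSq.left τ → FreeSq B (h ≫ k) (h' ≫ k'))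
    (fun s t e => mk (s.sq.hcomp t.sq e))
    (fun s t s' t' H H' => by
      refine Function.hfunext ?_ ?_
      · exact propext ⟨fun e => (FormalRel.sides H).2.symm.trans (e.trans (FormalRel.sides H').1),
          fun e => (FormalRel.sides H).2.trans (e.trans (FormalRel.sides H').1.symm)⟩
      · intro e e' _
        exact heq_of_eq (sound (FormalRel.hcomp_congr e e' H H'))) e

@[elab_as_elim]
theorem ind {a b c d : B.Obj} {h : a ⟶ b} {k : c ⟶ d} {P : FreeSq B h k → Prop}
    (H : ∀ (f : B.VHom a c) (g : B.VHom b d) (σ : FormalSq B h k f g), P (mk σ))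
    (σ : FreeSq B h k) : P σ :=
  Quotient.ind (fun s => H s.left s.right s.sq) σ

theorem iso_hom_inv {a b : B.Obj} {h k : a ⟶ b} (i : h ≅ k) :
    vcomp (mk (.cell i.hom)) (mk (.cell i.inv)) = mk (.vid h) :=
  sound (.trans (.cell_vcomp i.hom i.inv) (i.hom_inv_id ▸ .cell_id h))

theorem iso_inv_hom {a b : B.Obj} {h k : a ⟶ b} (i : h ≅ k) :
    vcomp (mk (.cell i.inv)) (mk (.cell i.hom)) = mk (.vid k) :=
  iso_hom_inv i.symm

/-- The square given by a 2-cell of `B`. -/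
abbrev ofCell {a b : B.Obj} {h k : a ⟶ b} (η : h ⟶ k) : FreeSq B h k :=
  mk (.cell η)

abbrev assoc {a b c d : B.Obj} (h : a ⟶ b) (k : b ⟶ c) (l : c ⟶ d) : FreeSq B ((h ≫ k) ≫ l) (h ≫ k ≫ l) := ofCell (α_ h k l).hom

abbrev assocInv {a b c d : B.Obj} (h : a ⟶ b) (k : b ⟶ c) (l : c ⟶ d) : FreeSq B (h ≫ k ≫ l) ((h ≫ k) ≫ l) := ofCell (α_ h k l).inv

abbrev lunit {a b : B.Obj} (h : a ⟶ b) : FreeSq B (𝟙 a ≫ h) h := ofCell (λ_ h).hom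

abbrev lunitInv {a b : B.Obj} (h : a ⟶ b) : FreeSq B h (𝟙 a ≫ h) := ofCell (λ_ h).inv

abbrev runit {a b : B.Obj} (h : a ⟶ b) : FreeSq B (h ≫ 𝟙 b) h := ofCell (ρ_ h).hom

abbrev runitInv {a b : B.Obj} (h : a ⟶ b) : FreeSq B h (h ≫ 𝟙 b) := ofCell (ρ_ h).inv

theorem hcomp_mk {a b c a' b' c' : B.Obj} {h : a ⟶ b} {k : b ⟶ c} {h' : a' ⟶ b'}
    {k' : b' ⟶ c'} {f : B.VHom a a'} {g g' : B.VHom b b'} {e : B.VHom c c'}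
    (σ : FormalSq B h h' f g) (τ : FormalSq B k k' g' e) (hg : g = g') :
    hcomp (mk σ) (mk τ) hg = mk (σ.hcomp τ hg) :=
  rfl

theorem hcomp_cell_vid {a b c : B.Obj} {h h' : a ⟶ b} (η : h ⟶ h') (k : b ⟶ c) :
    hcomp (mk (.cell η)) (mk (.vid k)) rfl = mk (.cell (η ▷ k)) := by
  refine sound (.trans (.hcomp_congr rfl rfl (.refl _) (.symm (.cell_id k)))
    (.trans (.cell_hcomp η (𝟙 k)) ?_))
  rw [whiskerLeft_id, Category.comp_id]
  exact .refl _

theorem hcomp_vid_cell {a b c : B.Obj} (h : a ⟶ b) {k k' : b ⟶ c} (θ : k ⟶ k') :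
    hcomp (mk (.vid h)) (mk (.cell θ)) rfl = mk (.cell (h ◁ θ)) := by
  refine sound (.trans (.hcomp_congr rfl rfl (.symm (.cell_id h)) (.refl _))
    (.trans (.cell_hcomp (𝟙 h) θ) ?_))
  rw [id_whiskerRight, Category.id_comp]
  exact .refl _

theorem hcomp_vid_vid {a b c : B.Obj} (h : a ⟶ b) (k : b ⟶ c) :
    hcomp (mk (.vid h)) (mk (.vid k)) rfl = mk (.vid (h ≫ k)) := by
  refine (sound (.hcomp_congr rfl rfl (.symm (.cell_id h)) (.refl _))).trans
    ((hcomp_cell_vid (𝟙 h) k).trans (sound ?_))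
  rw [id_whiskerRight]
  exact .cell_id _

theorem vcomp_cell {a b : B.Obj} {h k l : a ⟶ b} (η : h ⟶ k) (θ : k ⟶ l) :
    vcomp (mk (.cell η)) (mk (.cell θ)) = mk (.cell (η ≫ θ)) :=
  sound (.cell_vcomp η θ)

theorem left_hcomp {a b c a' b' c' : B.Obj} {h : a ⟶ b} {k : b ⟶ c} {h' : a' ⟶ b'}
    {k' : b' ⟶ c'} (σ : FreeSq B h h') (τ : FreeSq B k k') (e : σ.right = τ.left) :
    (hcomp σ τ e).left = σ.left := by
  induction σ using ind with | H f g s =>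
  induction τ using ind with | H f' g' t =>
  rfl

theorem right_hcomp {a b c a' b' c' : B.Obj} {h : a ⟶ b} {k : b ⟶ c} {h' : a' ⟶ b'}
    {k' : b' ⟶ c'} (σ : FreeSq B h h') (τ : FreeSq B k k') (e : σ.right = τ.left) :
    (hcomp σ τ e).right = τ.right := by
  induction σ using ind with | H f g s =>
  induction τ using ind with | H f' g' t =>
  rfl

theorem pentagon {a b c d p : B.Obj} (f : a ⟶ b) (g : b ⟶ c) (h : c ⟶ d) (i : d ⟶ p) :
    vcomp (hcomp (mk (.cell (α_ f g h).hom)) (mk (.vid i)) rfl)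
        (vcomp (mk (.cell (α_ f (g ≫ h) i).hom))
          (hcomp (mk (.vid f)) (mk (.cell (α_ g h i).hom)) rfl)) =
      vcomp (mk (.cell (α_ (f ≫ g) h i).hom)) (mk (.cell (α_ f g (h ≫ i)).hom)) := by
  rw [hcomp_cell_vid, hcomp_vid_cell, vcomp_cell, vcomp_cell, vcomp_cell, Bicategory.pentagon]

theorem triangle {a b c : B.Obj} (f : a ⟶ b) (g : b ⟶ c) :
    vcomp (mk (.cell (α_ f (𝟙 b) g).hom)) (hcomp (mk (.vid f)) (mk (.cell (λ_ g).hom)) rfl) =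
      hcomp (mk (.cell (ρ_ f).hom)) (mk (.vid g)) rfl := by
  rw [hcomp_cell_vid, hcomp_vid_cell, vcomp_cell, Bicategory.triangle]

end FreeSq

/-- The free globularly generated double category `Q_B` of a decorated bicategory `B`. Its category
of objects is the decoration of `B`, its horizontal morphisms are the 1-cells of `B`, and its
squares are formally generated by the 2-cells of `B` and by horizontal identity squares of vertical
morphisms. -/
def free : DoubleCategory.{u, x, v, max u x v w} where
  Obj := B.Vert
  HHom a b := @Quiver.Hom B.Obj _ a b
  Sq h k := FreeSq B h k
  vid h := FreeSq.mk (.vid h)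
  vcomp σ τ := FreeSq.vcomp σ τ
  vid_vcomp σ := FreeSq.ind (fun _ _ s => FreeSq.sound (.vid_vcomp s)) σ
  vcomp_vid σ := FreeSq.ind (fun _ _ s => FreeSq.sound (.vcomp_vid s)) σ
  vcomp_assoc σ τ υ := FreeSq.ind (fun _ _ s => FreeSq.ind (fun _ _ t => FreeSq.ind
    (fun _ _ r => FreeSq.sound (.vcomp_assoc s t r)) υ) τ) σ
  left σ := FreeSq.left σ
  right σ := FreeSq.right σ
  left_vid _ := rfl
  right_vid _ := rfl
  left_vcomp σ τ := FreeSq.ind (fun _ _ _ => FreeSq.ind (fun _ _ _ => rfl) τ) σ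
  right_vcomp σ τ := FreeSq.ind (fun _ _ _ => FreeSq.ind (fun _ _ _ => rfl) τ) σ
  hid a := @CategoryStruct.id B.Obj _ a
  hidSq f := FreeSq.mk (.unit f)
  left_hidSq _ := rfl
  right_hidSq _ := rfl
  hidSq_id a := FreeSq.sound (.unit_id (B := B) a)
  hidSq_comp f g := (FreeSq.sound (.unit_vcomp (B := B) f g)).symm
  hcomp h k := @CategoryStruct.comp B.Obj _ _ _ _ h k
  hcompSq σ τ e := FreeSq.hcomp σ τ e
  left_hcompSq σ τ e := FreeSq.left_hcomp σ τ e
  right_hcompSq σ τ e := FreeSq.right_hcomp σ τ e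
  hcompSq_vid h k := FreeSq.hcomp_vid_vid (B := B) h k
  interchange σ τ σ' τ' := FreeSq.ind (fun _ _ s => FreeSq.ind (fun _ _ t => FreeSq.ind
    (fun _ _ s' => FreeSq.ind (fun _ _ t' e e' =>
      FreeSq.sound (.interchange s t s' t' e e')) τ') σ') τ) σ
  assoc h k l := FreeSq.assoc (B := B) h k l
  assocInv h k l := FreeSq.assocInv (B := B) h k l
  left_assoc _ _ _ := rfl
  right_assoc _ _ _ := rfl
  left_assocInv _ _ _ := rfl
  right_assocInv _ _ _ := rfl
  assoc_assocInv h k l := (FreeSq.iso_hom_inv (associator (B := B.Obj) h k l) :)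
  assocInv_assoc h k l := (FreeSq.iso_inv_hom (associator (B := B.Obj) h k l) :)
  assoc_natural σ τ υ := FreeSq.ind (fun _ _ s => FreeSq.ind (fun _ _ t => FreeSq.ind
    (fun _ _ r e e' => FreeSq.sound (.assoc_natural s t r e e')) υ) τ) σ
  lunit h := FreeSq.lunit (B := B) h
  lunitInv h := FreeSq.lunitInv (B := B) h
  left_lunit _ := rfl
  right_lunit _ := rfl
  left_lunitInv _ := rfl
  right_lunitInv _ := rfl
  lunit_lunitInv h := (FreeSq.iso_hom_inv (leftUnitor (B := B.Obj) h) :)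
  lunitInv_lunit h := (FreeSq.iso_inv_hom (leftUnitor (B := B.Obj) h) :)
  lunit_natural σ := FreeSq.ind (fun _ _ s => FreeSq.sound (.lunit_natural s)) σ
  runit h := FreeSq.runit (B := B) h
  runitInv h := FreeSq.runitInv (B := B) h
  left_runit _ := rfl
  right_runit _ := rfl
  left_runitInv _ := rfl
  right_runitInv _ := rfl
  runit_runitInv h := (FreeSq.iso_hom_inv (rightUnitor (B := B.Obj) h) :)
  runitInv_runit h := (FreeSq.iso_inv_hom (rightUnitor (B := B.Obj) h) :)
  runit_natural σ := FreeSq.ind (fun _ _ s => FreeSq.sound (.runit_natural s)) σ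
  pentagon f g h i := FreeSq.pentagon (B := B) f g h i
  triangle f g := FreeSq.triangle (B := B) f g

/-- The inclusion of `B` into the decorated horizontalization of `Q_B`. It is the identity on
0-cells, 1-cells and vertical morphisms and sends a 2-cell to its class as a square. -/
def inclusion : DecoratedPseudofunctor B B.free.decHor where
  hor := (StrictPseudofunctor.mk' (B := B.Obj) (C := B.free.Hor)
    { obj := fun a => a
      map := fun h => h
      map₂ := fun η => (⟨FreeSq.ofCell η, rfl, rfl⟩ : B.free.Glob _ _)
      map₂_id := fun h => DoubleCategory.Glob.ext (FreeSq.sound (.cell_id h))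
      map₂_comp := fun η θ => DoubleCategory.Glob.ext (FreeSq.vcomp_cell η θ).symm
      map_id := fun _ => rfl
      map_comp := fun _ _ => rfl
      map₂_whisker_left := fun h _ _ η => StrictDoubleFunctor.eq_of_heq_sq (D := B.free)
        rfl rfl _ _ (heq_of_eq (FreeSq.hcomp_vid_cell h η).symm)
      map₂_whisker_right := fun η k => StrictDoubleFunctor.eq_of_heq_sq (D := B.free)
        rfl rfl _ _ (heq_of_eq (FreeSq.hcomp_cell_vid η k).symm)
      map₂_associator := fun _ _ _ => StrictDoubleFunctor.eq_of_heq_sq (D := B.free)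
        rfl rfl _ _ HEq.rfl
      map₂_left_unitor := fun _ => StrictDoubleFunctor.eq_of_heq_sq_left (D := B.free)
        rfl _ _ HEq.rfl
      map₂_right_unitor := fun _ => StrictDoubleFunctor.eq_of_heq_sq_left (D := B.free)
        rfl _ _ HEq.rfl }).toPseudofunctor
  vert := 𝟭 B.Vert
  obj_eq _ := rfl

end DecoratedBicategory

/-!
The theorem says that `Q_B` is free on `B` among globularly generated double categories with
horizontalization `B`. After replacing `B` by `H^* C`, a 2-cell of `B` is literally a globular
square of `C`, so every formal square can be read in `C`: a 2-cell as itself, a formal horizontal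
identity as `C.hidSq`, formal composites as the composites of `C`. This reading is
`FormalSq.eval`; it keeps track of the vertical sides because horizontal composition in `C` is only
defined for squares with matching sides. Each defining relation of `Q_B` follows from the axioms of `C`
(`FormalRel.eval_eq`), so the reading descends to classes (`FreeSq.eval`) and gives the strict
double functor `canonicalProjection`, which is the identity on objects, vertical morphisms and
horizontal morphisms.

Surjectivity is the hypothesis that `C` is globularly generated: the values of `FreeSq.eval` contain
the globular and the horizontal identity squares, and are closed under both compositions. For
uniqueness, the condition `H^* π' ∘ j_B = id` determines `π'` on vertical and horizontal morphisms
and on 2-cells; strictness determines it on formal horizontal identities and on composites, hence on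
all formal squares by induction.
-/

open DoubleCategory DecoratedBicategory

namespace CategoryTheory.Pseudofunctor

variable {X : Type*} [Bicategory X] {Y : Type*} [Bicategory Y] {F G : Pseudofunctor X Y}

theorem eq_of_toPrelaxFunctor_eq (H : F.toPrelaxFunctor = G.toPrelaxFunctor)
    (hId : ∀ a, HEq (F.mapId a) (G.mapId a))
    (hComp : ∀ {a b c : X} (h : a ⟶ b) (k : b ⟶ c), HEq (F.mapComp h k) (G.mapComp h k)) :
    F = G := by
  obtain ⟨F', mapId, mapComp⟩ := F
  obtain ⟨G', mapId', mapComp'⟩ := G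
  dsimp only at H
  subst H
  have h₁ : mapId = mapId' := funext fun a => eq_of_heq (hId a)
  have h₂ : @mapComp = @mapComp' := by
    funext a b c h k
    exact eq_of_heq (hComp h k)
  subst h₁ h₂
  rfl

theorem map_heq_of_eq (H : F = G) {a b : X} (h : a ⟶ b) : HEq (F.map h) (G.map h) := by
  subst H; rfl

theorem map₂_heq_of_eq (H : F = G) {a b : X} {h k : a ⟶ b} (η : h ⟶ k) :
    HEq (F.map₂ η) (G.map₂ η) := by
  subst H; rfl

end CategoryTheory.Pseudofunctor

section

variable {C : DoubleCategory.{u, x, v, w}}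

namespace DecoratedBicategory

/-- The value in `C` of a formal square over `H^* C`, bundled with the computation of its vertical
sides, which is what makes the horizontal composites well defined. -/
def FormalSq.eval : ∀ {a b c d : C.decHor.Obj} {h : a ⟶ b} {k : c ⟶ d} {f : C.decHor.VHom a c}
    {g : C.decHor.VHom b d}, FormalSq C.decHor h k f g →
    {s : C.Sq (a := a) (b := b) (c := c) (d := d) h k // C.left s = f ∧ C.right s = g}
  | _, _, _, _, _, _, _, _, .cell η => ⟨Glob.sq η, Glob.glob η⟩
  | _, _, _, _, _, _, _, _, .unit f => ⟨C.hidSq f, C.left_hidSq f, C.right_hidSq f⟩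
  | _, _, _, _, _, _, _, _, .vid h => ⟨C.vid h, C.left_vid h, C.right_vid h⟩
  | _, _, _, _, _, _, _, _, .vcomp σ τ =>
    ⟨C.vcomp σ.eval.1 τ.eval.1,
      (C.left_vcomp _ _).trans (congrArg₂ (· ≫ ·) σ.eval.2.1 τ.eval.2.1),
      (C.right_vcomp _ _).trans (congrArg₂ (· ≫ ·) σ.eval.2.2 τ.eval.2.2)⟩
  | _, _, _, _, _, _, _, _, .hcomp σ τ hg =>
    ⟨C.hcompSq σ.eval.1 τ.eval.1 (σ.eval.2.2.trans (hg.trans τ.eval.2.1.symm)),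
      (C.left_hcompSq _ _ _).trans σ.eval.2.1, (C.right_hcompSq _ _ _).trans τ.eval.2.2⟩

/-- Related formal squares have the same value: the relations of the free double category follow from
the axioms of `C`. -/
theorem FormalRel.eval_eq {a b c d : C.decHor.Obj} {h : a ⟶ b} {k : c ⟶ d}
    {f f' : C.decHor.VHom a c} {g g' : C.decHor.VHom b d} {σ : FormalSq C.decHor h k f g}
    {σ' : FormalSq C.decHor h k f' g'} (H : FormalRel C.decHor σ σ') : σ.eval.1 = σ'.eval.1 := by
  induction H with
  | refl => rfl
  | symm _ ih => exact ih.symm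
  | trans _ _ ih ih' => exact ih.trans ih'
  | vcomp_congr _ _ ih ih' => exact congrArg₂ C.vcomp ih ih'
  | hcomp_congr _ _ _ _ ih ih' => exact hcompSq_congr ih ih' _ _
  | vid_vcomp => exact C.vid_vcomp _
  | vcomp_vid => exact C.vcomp_vid _
  | vcomp_assoc => exact C.vcomp_assoc _ _ _
  | interchange => exact C.interchange _ _ _ _ _ _
  | cell_id | cell_vcomp => rfl
  | unit_id a => exact C.hidSq_id a
  | unit_vcomp f g => exact (C.hidSq_comp f g).symm
  | cell_hcomp η θ =>
    -- in `H^* C` the whiskerings are horizontal composites with vertical identities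
    refine Eq.trans ?_ (hcomp_exchange (C := C) η ⟨C.vid _, IsGlobular.vid _⟩
      ⟨C.vid _, IsGlobular.vid _⟩ θ).symm
    exact hcompSq_congr (C.vcomp_vid _).symm (C.vid_vcomp _).symm _ _
  | lunit_natural σ =>
    refine Eq.trans ?_ (C.lunit_natural σ.eval.1)
    exact congrArg (fun s => C.vcomp s _)
      (hcompSq_congr (congrArg C.hidSq σ.eval.2.1.symm) rfl _ _)
  | runit_natural σ =>
    refine Eq.trans ?_ (C.runit_natural σ.eval.1)
    exact congrArg (fun s => C.vcomp s _)
      (hcompSq_congr rfl (congrArg C.hidSq σ.eval.2.2.symm) _ _)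
  | assoc_natural σ τ υ => exact C.assoc_natural σ.eval.1 τ.eval.1 υ.eval.1 _ _

/-- The value in `C` of a square of the free double category on `H^* C`. -/
def FreeSq.eval {a b c d : C.decHor.Obj} {h : a ⟶ b} {k : c ⟶ d} (σ : FreeSq C.decHor h k) :
    C.Sq (a := a) (b := b) (c := c) (d := d) h k :=
  Quotient.lift (fun s : FormalSquare C.decHor h k => s.sq.eval.1)
    (fun _ _ H => FormalRel.eval_eq H) σ

end DecoratedBicategory

namespace DoubleCategory

variable (C)

/-- The strict double functor `π^C : Q_{H^* C} → C`, the identity on objects, vertical morphisms and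
horizontal morphisms, evaluating the formal composites in `C`. -/
def canonicalProjection : StrictDoubleFunctor C.decHor.free C where
  vert := 𝟭 C.Obj
  mapH h := h
  mapSq σ := FreeSq.eval σ
  left_mapSq σ := FreeSq.ind (fun _ _ s => s.eval.2.1) σ
  right_mapSq σ := FreeSq.ind (fun _ _ s => s.eval.2.2) σ
  map_vid _ := rfl
  map_vcomp σ τ := FreeSq.ind (fun _ _ _ => FreeSq.ind (fun _ _ _ => rfl) τ) σ
  map_hid _ := rfl
  map_hidSq _ := HEq.rfl
  map_hcomp _ _ := rfl
  map_hcompSq σ τ := FreeSq.ind (fun _ _ _ => FreeSq.ind (fun _ _ _ _ => HEq.rfl) τ) σ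
  map_assoc _ _ _ := HEq.rfl
  map_lunit _ := HEq.rfl
  map_runit _ := HEq.rfl

variable {C}

/-- The image of the projection contains the globular and the horizontal identity squares and is
closed under both compositions. Preimages of horizontally composable squares are composable because
the projection does not change vertical sides. -/
theorem GlobularlyGeneratedSq.exists_mapSq_eq {a b c d : C.Obj} {h : C.HHom a b} {k : C.HHom c d}
    {σ : C.Sq h k} (H : C.GlobularlyGeneratedSq σ) :
    ∃ s : C.decHor.free.Sq (a := a) (b := b) (c := c) (d := d) h k,
      C.canonicalProjection.mapSq s = σ := by
  induction H with
  | glob σ hσ => exact ⟨FreeSq.ofCell (B := C.decHor) (⟨σ, hσ⟩ : C.Glob _ _), rfl⟩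
  | hidSq f => exact ⟨C.decHor.free.hidSq f, rfl⟩
  | vcomp σ τ _ _ ihσ ihτ =>
    obtain ⟨s, rfl⟩ := ihσ
    obtain ⟨t, rfl⟩ := ihτ
    exact ⟨C.decHor.free.vcomp s t, C.canonicalProjection.map_vcomp s t⟩
  | hcompSq σ τ e _ _ ihσ ihτ =>
    obtain ⟨s, rfl⟩ := ihσ
    obtain ⟨t, rfl⟩ := ihτ
    have e' : C.decHor.free.right s = C.decHor.free.left t :=
      (C.canonicalProjection.right_mapSq s).symm.trans
        (e.trans (C.canonicalProjection.left_mapSq t))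
    exact ⟨C.decHor.free.hcompSq s t e', eq_of_heq (C.canonicalProjection.map_hcompSq s t e')⟩

theorem IsGlobularlyGenerated.surjectiveOnSquares (hC : C.IsGlobularlyGenerated) :
    C.canonicalProjection.SurjectiveOnSquares := by
  rintro ⟨h, k, σ⟩
  obtain ⟨s, rfl⟩ := (hC σ).exists_mapSq_eq
  exact ⟨⟨_, _, s⟩, rfl⟩

theorem inclusion_comp_canonicalProjection :
    C.decHor.inclusion.comp C.canonicalProjection.decHor = DecoratedPseudofunctor.id C.decHor := by
  refine DecoratedPseudofunctor.ext (Pseudofunctor.eq_of_toPrelaxFunctor_eq rfl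
    (fun a => heq_of_eq (Iso.ext ?_)) (fun h k => heq_of_eq (Iso.ext ?_))) rfl
  -- all structure isomorphisms are `eqToIso` of reflexive equalities, so only `map₂ (𝟙 _) = 𝟙 _`
  -- and a unit law remain
  · exact (Category.comp_id _).trans (C.canonicalProjection.horStrict.map₂_id _)
  · exact (Category.comp_id _).trans (C.canonicalProjection.horStrict.map₂_id _)

/-- Uniqueness: the condition fixes `π` on vertical morphisms, horizontal morphisms and 2-cells, and
by induction on formal squares strictness forces its value on a class to be `FormalSq.eval`. -/
theorem eq_canonicalProjection (π : StrictDoubleFunctor C.decHor.free C)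
    (H : C.decHor.inclusion.comp π.decHor = DecoratedPseudofunctor.id C.decHor) :
    π = C.canonicalProjection := by
  have hvert : π.vert = 𝟭 C.Obj := congrArg DecoratedPseudofunctor.vert H
  have hhor := congrArg DecoratedPseudofunctor.hor H
  have hmap : ∀ {a b : C.Obj} (h : C.HHom a b), HEq (π.mapH h) h :=
    fun {a b} h => Pseudofunctor.map_heq_of_eq hhor (a := a) (b := b) h
  have hcell : ∀ {a b : C.decHor.Obj} {h k : a ⟶ b} (η : h ⟶ k),
      HEq (π.mapGlob ⟨FreeSq.ofCell (B := C.decHor) η, rfl, rfl⟩) η :=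
    fun η => Pseudofunctor.map₂_heq_of_eq hhor η
  clear hhor H
  -- once `vert` and `mapH` are replaced by identities, all heterogeneous equalities below relate
  -- terms of the same type
  obtain ⟨vert, mapH, mapSq, left_mapSq, right_mapSq, map_vid, map_vcomp, map_hid, map_hidSq,
    map_hcomp, map_hcompSq, map_assoc, map_lunit, map_runit⟩ := π
  dsimp only at hvert
  subst hvert
  have hmapH : @mapH = fun {a b} h => h := by
    funext a b h
    exact eq_of_heq (hmap h)
  subst hmapH
  have hmk : ∀ {a b c d : C.decHor.Obj} {h : a ⟶ b} {k : c ⟶ d} {f : C.decHor.VHom a c}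
      {g : C.decHor.VHom b d} (s : FormalSq C.decHor h k f g),
      mapSq (FreeSq.mk s) = s.eval.1 := by
    intro a b c d h k f g s
    induction s with
    | cell η => exact congrArg Glob.sq (eq_of_heq (hcell η))
    | unit f => exact eq_of_heq (map_hidSq f)
    | vid h => exact map_vid h
    | vcomp s t ihs iht =>
      exact (map_vcomp (FreeSq.mk s) (FreeSq.mk t)).trans (congrArg₂ C.vcomp ihs iht)
    | hcomp s t hg ihs iht =>
      exact (eq_of_heq (map_hcompSq (FreeSq.mk s) (FreeSq.mk t) hg)).trans
        (hcompSq_congr ihs iht _ _)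
  have hmapSq : @mapSq = @FreeSq.eval C := by
    funext a b c d h k σ
    exact FreeSq.ind (fun _ _ s => hmk s) σ
  subst hmapSq
  rfl

end DoubleCategory

end

theorem theorem2p1 (B : DecoratedBicategory.{u, x, v, w}) (C : DoubleCategory.{u, x, v, w})
    (hC : C.IsGlobularlyGenerated) (hB : C.decHor = B) :
    ∃ π : StrictDoubleFunctor B.free C,
      (B.inclusion.comp π.decHor = DecoratedPseudofunctor.ofEq hB.symm ∧
        π.SurjectiveOnSquares) ∧
      ∀ π' : StrictDoubleFunctor B.free C,
        B.inclusion.comp π'.decHor = DecoratedPseudofunctor.ofEq hB.symm → π' = π := by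
  subst hB
  exact ⟨C.canonicalProjection, ⟨inclusion_comp_canonicalProjection, hC.surjectiveOnSquares⟩,
    fun π' H => eq_canonicalProjection π' H⟩
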